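/- For Hermitian positive definite matrices $X,Y\in\mathbb{C}^{n\times n}$ (written $X,Y>0$) let $$S(X,Y)=\log\det\Bigl(\frac{X+Y}{2}\Bigr)-\frac12\log\det(XY).$$ Let $A_1,\dots,A_m\in\mathbb{C}^{n\times n}$ be Hermitian positive definite, let $w_1,\dots,w_m\ge 0$ satisfy $\sum_{i=1}^m w_i=1$, and put $h(X)=\sum_{i=1}^m w_i\,S(X,A_i)$ for $X>0$. Then the equation $$X^{-1}=\sum_{i=1}^m w_i\Bigl(\frac{X+A_i}{2}\Bigr)^{-1}$$ has exactly one Hermitian positive definite solution $X$, and this $X$ is the unique global minimizer of $h$ over all Hermitian positive definite matrices. This holds although, for every $n\ge 1$, the function $h$ is not convex on the cone of Hermitian positive definite matrices. -/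

import Mathlib

open scoped ComplexOrder

noncomputable section

namespace SDivergence

/-- The cone of `n × n` Hermitian positive definite complex matrices. -/
def posDefCone (n : ℕ) : Set (Matrix (Fin n) (Fin n) ℂ) := {X | X.PosDef}

/-- The S-Divergence `S(X, Y) = log det ((X + Y) / 2) - (1 / 2) log det (X Y)`, for positive
definite `X`, `Y`. Both determinants are then positive real numbers, so that taking the real part
only changes the type. -/
def sDiv {n : ℕ} (X Y : Matrix (Fin n) (Fin n) ℂ) : ℝ :=
  Real.log (((1 / 2 : ℂ) • (X + Y)).det).re - 1 / 2 * Real.log ((X * Y).det).re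

/-- The objective `h(X) = ∑ i, w i * S(X, A i)`. -/
def objective {n m : ℕ} (w : Fin m → ℝ) (A : Fin m → Matrix (Fin n) (Fin n) ℂ)
    (X : Matrix (Fin n) (Fin n) ℂ) : ℝ :=
  ∑ i, w i * sDiv X (A i)

/-- The nonlinear matrix equation `X⁻¹ = ∑ i, w i * ((X + A i) / 2)⁻¹`. -/
def MeanEquation {n m : ℕ} (w : Fin m → ℝ) (A : Fin m → Matrix (Fin n) (Fin n) ℂ)
    (X : Matrix (Fin n) (Fin n) ℂ) : Prop :=
  X⁻¹ = ∑ i, (w i : ℂ) • ((1 / 2 : ℂ) • (X + A i))⁻¹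

end SDivergence

end

/-! Existence is by compactness. If `a • 1 ≤ A i` for all `i`, monotonicity of `log det` bounds
`h(X)` below, up to a constant, by the sum of `log ((λ + a) / 2) - 1/2 log λ` over the eigenvalues
`λ` of `X`. Each term blows up as `λ` tends to `0` or `∞`, so a sublevel set lies in a compact
`spectralBox` and `h` attains its minimum. There the gradient vanishes, which is the equation.

Since `h` is not convex, uniqueness comes from the Loewner order: for solutions `X`, `Y`, the least
`c ≥ 1` with `Y ≤ c X` could be lowered if `c > 1` (`MeanEquation.sub_posSemidef`). Hence `Y ≤ X`,
and by symmetry `X = Y`. So the only solution is the minimizer, and every minimizer is that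
solution.

Convexity fails because `h (T • 1)` grows like `n/2 log T`. -/

namespace Matrix

variable {n : ℕ}

/-! ### Loewner order, determinants and their derivatives -/

theorem IsHermitian.sub_smul_one_posSemidef {H : Matrix (Fin n) (Fin n) ℂ} (hH : H.IsHermitian)
    {c : ℝ} (hc : ∀ i, c ≤ hH.eigenvalues i) : (H - c • 1).PosSemidef := by
  have h1 : H - c • 1 = (hH.eigenvectorUnitary : Matrix (Fin n) (Fin n) ℂ) *
      diagonal (fun i => ((hH.eigenvalues i - c : ℝ) : ℂ)) *
      (hH.eigenvectorUnitary : Matrix (Fin n) (Fin n) ℂ)ᴴ := by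
    have h2 : diagonal (fun i => ((hH.eigenvalues i - c : ℝ) : ℂ)) =
        diagonal (RCLike.ofReal ∘ hH.eigenvalues) - c • (1 : Matrix (Fin n) (Fin n) ℂ) := by
      ext i j
      by_cases h : i = j
      · subst h; simp
      · simp [h]
    have h3 := hH.spectral_theorem
    rw [Unitary.conjStarAlgAut_apply] at h3
    have h4 := Unitary.coe_mul_star_self hH.eigenvectorUnitary
    rw [Unitary.coe_star] at h4
    rw [star_eq_conjTranspose] at h3 h4
    rw [h2, mul_sub, sub_mul, ← h3, mul_smul_comm, mul_one, smul_mul_assoc, h4]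
  rw [h1]
  refine PosSemidef.mul_mul_conjTranspose_same (PosSemidef.diagonal fun i => ?_) _
  simpa using hc i

theorem IsHermitian.exists_sub_smul_one_posSemidef {H : Matrix (Fin n) (Fin n) ℂ}
    (hH : H.IsHermitian) : ∃ c : ℝ, (H - c • 1).PosSemidef := by
  obtain ⟨c, hc⟩ := (Set.finite_range hH.eigenvalues).bddBelow
  exact ⟨c, hH.sub_smul_one_posSemidef fun i => hc ⟨i, rfl⟩⟩

theorem IsHermitian.exists_smul_one_sub_posSemidef {H : Matrix (Fin n) (Fin n) ℂ}
    (hH : H.IsHermitian) : ∃ c : ℝ, (c • 1 - H).PosSemidef := by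
  obtain ⟨c, hc⟩ := hH.neg.exists_sub_smul_one_posSemidef
  refine ⟨-c, ?_⟩
  convert hc using 1
  rw [neg_smul]; abel

theorem PosDef.exists_pos_sub_smul_one_posSemidef {X : Matrix (Fin n) (Fin n) ℂ}
    (hX : X.PosDef) : ∃ c : ℝ, 0 < c ∧ (X - c • 1).PosSemidef := by
  rcases isEmpty_or_nonempty (Fin n) with h | h
  · exact ⟨1, one_pos, hX.1.sub_smul_one_posSemidef fun i => h.elim i⟩
  · obtain ⟨i, hi⟩ := Finite.exists_min hX.1.eigenvalues
    exact ⟨_, hX.eigenvalues_pos i, hX.1.sub_smul_one_posSemidef hi⟩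

theorem PosSemidef.real_smul {X : Matrix (Fin n) (Fin n) ℂ} (hX : X.PosSemidef) {c : ℝ}
    (hc : 0 ≤ c) : (c • X).PosSemidef := hX.smul hc

theorem PosDef.real_smul {X : Matrix (Fin n) (Fin n) ℂ} (hX : X.PosDef) {c : ℝ}
    (hc : 0 < c) : (c • X).PosDef := hX.smul hc

theorem PosSemidef.trans_sub {X Y Z : Matrix (Fin n) (Fin n) ℂ} (h1 : (X - Y).PosSemidef)
    (h2 : (Y - Z).PosSemidef) : (X - Z).PosSemidef := by
  simpa using h1.add h2

theorem exists_pos_forall_sub_smul_one_posSemidef {m : ℕ}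
    {A : Fin m → Matrix (Fin n) (Fin n) ℂ} (hA : ∀ i, (A i).PosDef) :
    ∃ c : ℝ, 0 < c ∧ ∀ i, (A i - c • 1).PosSemidef := by
  choose c hc hcA using fun i => (hA i).exists_pos_sub_smul_one_posSemidef
  obtain ⟨d, hd, hdc⟩ : ∃ d : ℝ, 0 < d ∧ ∀ i, d ≤ c i := by
    rcases isEmpty_or_nonempty (Fin m) with h | h
    · exact ⟨1, one_pos, fun i => h.elim i⟩
    · obtain ⟨i, hi⟩ := Finite.exists_min c
      exact ⟨_, hc i, hi⟩
  refine ⟨d, hd, fun i => (hcA i).trans_sub ?_⟩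
  rw [← sub_smul]
  exact PosSemidef.one.real_smul (sub_nonneg.2 (hdc i))

theorem exists_forall_smul_one_sub_posSemidef {m : ℕ}
    {A : Fin m → Matrix (Fin n) (Fin n) ℂ} (hA : ∀ i, (A i).IsHermitian) :
    ∃ c : ℝ, ∀ i, (c • 1 - A i).PosSemidef := by
  choose c hcA using fun i => (hA i).exists_smul_one_sub_posSemidef
  obtain ⟨d, hd⟩ := (Set.finite_range c).bddAbove
  refine ⟨d, fun i => PosSemidef.trans_sub ?_ (hcA i)⟩
  rw [← sub_smul]
  exact PosSemidef.one.real_smul (sub_nonneg.2 (hd ⟨i, rfl⟩))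

theorem IsHermitian.det_add_smul_one {X : Matrix (Fin n) (Fin n) ℂ} (hX : X.IsHermitian)
    (a : ℝ) : (X + a • 1).det = ((∏ i, (hX.eigenvalues i + a) : ℝ) : ℂ) := by
  have h := congrArg (Polynomial.eval (-(a : ℂ))) hX.charpoly_eq
  rw [eval_charpoly, Polynomial.eval_prod] at h
  have h2 : scalar (Fin n) (-(a : ℂ)) - X = -(X + a • 1) := by
    ext i j
    by_cases h : i = j
    · subst h; simp; ring
    · simp [h]
  rw [h2, det_neg] at h
  have h3 : ∀ i, Polynomial.eval (-(a : ℂ)) (Polynomial.X - Polynomial.C (hX.eigenvalues i : ℂ)) =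
      -1 * ((hX.eigenvalues i + a : ℝ) : ℂ) := fun i => by simp; ring
  simp only [RCLike.ofReal_eq_complex_ofReal] at h
  simp only [Polynomial.eval_sub, Polynomial.eval_X, Polynomial.eval_C] at h h3
  rw [Finset.prod_congr rfl fun i _ => h3 i, Finset.prod_mul_distrib] at h
  simp only [Finset.prod_const, Finset.card_univ] at h
  rw [Complex.ofReal_prod]
  exact mul_left_cancel₀ (pow_ne_zero _ (by norm_num)) h

theorem PosDef.ofReal_re_det {X : Matrix (Fin n) (Fin n) ℂ} (hX : X.PosDef) :
    ((X.det.re : ℝ) : ℂ) = X.det := by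
  have := (Complex.lt_def.1 hX.det_pos).2
  exact Complex.ext rfl (by simpa using this)

theorem PosDef.re_det_pos {X : Matrix (Fin n) (Fin n) ℂ} (hX : X.PosDef) : 0 < X.det.re :=
  (Complex.lt_def.1 hX.det_pos).1

theorem PosSemidef.one_le_re_det_add_one {Q : Matrix (Fin n) (Fin n) ℂ} (hQ : Q.PosSemidef) :
    1 ≤ (1 + Q).det.re := by
  have h := hQ.1.det_add_smul_one 1
  rw [one_smul, add_comm] at h
  rw [h, Complex.ofReal_re]
  exact Finset.one_le_prod fun i _ => by linarith [hQ.eigenvalues_nonneg i]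

open scoped MatrixOrder in
theorem PosSemidef.exists_eq_conjTranspose_mul_self {P : Matrix (Fin n) (Fin n) ℂ}
    (hP : P.PosSemidef) : ∃ C : Matrix (Fin n) (Fin n) ℂ, P = Cᴴ * C :=
  CStarAlgebra.nonneg_iff_eq_star_mul_self.1 hP.nonneg

/-- With `Y - X = Cᴴ * C`, Sylvester's identity gives `det Y = det X * det (1 + C * X⁻¹ * Cᴴ)`, and
the last factor is at least `1`. -/
theorem PosDef.re_det_le_re_det {X Y : Matrix (Fin n) (Fin n) ℂ} (hX : X.PosDef)
    (h : (Y - X).PosSemidef) : X.det.re ≤ Y.det.re := by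
  obtain ⟨C, hC⟩ := h.exists_eq_conjTranspose_mul_self
  have hQ := hX.inv.posSemidef.mul_mul_conjTranspose_same C
  have hY : Y = X * (1 + X⁻¹ * Cᴴ * C) := by
    rw [mul_add, mul_one, mul_assoc, ← mul_assoc, mul_nonsing_inv _ hX.det_pos.ne'.isUnit, one_mul,
      ← hC]
    abel
  rw [hY, det_mul, det_one_add_mul_comm, ← hX.ofReal_re_det, Complex.re_ofReal_mul, ← mul_assoc]
  simp only [Complex.ofReal_re]
  exact le_mul_of_one_le_right hX.re_det_pos.le hQ.one_le_re_det_add_one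

theorem PosDef.log_re_det_le {X Y : Matrix (Fin n) (Fin n) ℂ} (hX : X.PosDef)
    (h : (Y - X).PosSemidef) : Real.log X.det.re ≤ Real.log Y.det.re :=
  Real.log_le_log hX.re_det_pos (hX.re_det_le_re_det h)

/-- `Y - X` and `X⁻¹ - Y⁻¹` are the two Schur complements of the block matrix `[Y, 1; 1, X⁻¹]`. -/
theorem PosDef.inv_sub_inv_posSemidef {X Y : Matrix (Fin n) (Fin n) ℂ} (hX : X.PosDef)
    (h : (Y - X).PosSemidef) : (X⁻¹ - Y⁻¹).PosSemidef := by
  have hY : Y.PosDef := by simpa using hX.add_posSemidef h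
  have := hX.isUnit.invertible
  have := hY.isUnit.invertible
  have := hX.inv.isUnit.invertible
  have h1 := (PosDef.fromBlocks₂₂ Y (1 : Matrix (Fin n) (Fin n) ℂ) hX.inv).2
    (by simpa [nonsing_inv_nonsing_inv _ hX.det_pos.ne'.isUnit] using h)
  simpa using (PosDef.fromBlocks₁₁ (1 : Matrix (Fin n) (Fin n) ℂ) X⁻¹ hY).1 h1

theorem PosDef.eventually_add_smul {X M : Matrix (Fin n) (Fin n) ℂ} (hX : X.PosDef)
    (hM : M.IsHermitian) : ∀ᶠ t : ℝ in nhds 0, (X + t • M).PosDef := by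
  obtain ⟨c, hc, hcX⟩ := hX.exists_pos_sub_smul_one_posSemidef
  obtain ⟨a, ha⟩ := hM.exists_sub_smul_one_posSemidef
  obtain ⟨b, hb⟩ := hM.exists_smul_one_sub_posSemidef
  have e1 : ∀ᶠ t : ℝ in nhds 0, 0 < c + t * a :=
    (Continuous.tendsto (by fun_prop) 0).eventually_const_lt (by simpa using hc)
  have e2 : ∀ᶠ t : ℝ in nhds 0, 0 < c + t * b :=
    (Continuous.tendsto (by fun_prop) 0).eventually_const_lt (by simpa using hc)
  filter_upwards [e1, e2] with t h1 h2
  rcases le_total 0 t with ht | ht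
  · convert PosDef.posSemidef_add (hcX.add (ha.real_smul ht)) (PosDef.one.real_smul h1) using 1
    module
  · convert PosDef.posSemidef_add (hcX.add (hb.real_smul (neg_nonneg.2 ht))) (PosDef.one.real_smul h2) using 1
    module

theorem hasDerivAt_re_det_add_smul {X : Matrix (Fin n) (Fin n) ℂ} (hX : X.det ≠ 0)
    (H : Matrix (Fin n) (Fin n) ℂ) :
    HasDerivAt (fun t : ℝ => (X + t • H).det.re) (X.det * (X⁻¹ * H).trace).re 0 := by
  have key : HasDerivAt (fun z : ℂ => (X + z • H).det) (X.det * (X⁻¹ * H).trace) ((0 : ℝ) : ℂ) := by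
    have e : ∀ z : ℂ, (X + z • H).det = X.det * (1 + (X⁻¹ * H).trace * z +
        (det (1 + (Polynomial.X : Polynomial ℂ) •
          (X⁻¹ * H).map Polynomial.C)).divX.divX.eval z * z ^ 2) := fun z => by
      rw [← det_one_add_smul, ← det_mul, mul_add, mul_one, mul_smul_comm, ← mul_assoc,
        mul_nonsing_inv _ hX.isUnit, one_mul]
    simp only [e]
    generalize (det (1 + (Polynomial.X : Polynomial ℂ) •
          (X⁻¹ * H).map Polynomial.C)).divX.divX = P
    have h := ((((hasDerivAt_id ((0 : ℝ) : ℂ)).const_mul (X⁻¹ * H).trace).const_add 1).add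
      ((P.hasDerivAt ((0 : ℝ) : ℂ)).mul ((hasDerivAt_id ((0 : ℝ) : ℂ)).pow 2))).const_mul X.det
    exact h.congr_deriv (by simp)
  exact key.real_of_complex

theorem hasDerivAt_log_re_det_add_smul {X : Matrix (Fin n) (Fin n) ℂ} (hX : 0 < X.det)
    (H : Matrix (Fin n) (Fin n) ℂ) :
    HasDerivAt (fun t : ℝ => Real.log (X + t • H).det.re) (X⁻¹ * H).trace.re 0 := by
  obtain ⟨h1, h2⟩ := Complex.lt_def.1 hX
  have h := (hasDerivAt_re_det_add_smul hX.ne' H).log (by simpa using h1.ne')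
  convert h using 1
  simp only [Complex.zero_re, Complex.zero_im] at h1 h2
  rw [Complex.mul_re, ← h2, zero_mul, sub_zero, zero_smul, add_zero, mul_div_cancel_left₀ _ h1.ne']

end Matrix

/-! ### Closedness and compactness -/

namespace Matrix

variable {n : ℕ}

theorem isClosed_setOf_posSemidef : IsClosed {M : Matrix (Fin n) (Fin n) ℂ | M.PosSemidef} := by
  have h : {M : Matrix (Fin n) (Fin n) ℂ | M.PosSemidef} =
      {M | Mᴴ = M} ∩ ⋂ x : Fin n → ℂ, {M | 0 ≤ star x ⬝ᵥ (M *ᵥ x)} := by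
    ext M
    simp [posSemidef_iff_dotProduct_mulVec, IsHermitian]
  rw [h]
  refine (isClosed_eq (by fun_prop) continuous_id).inter (isClosed_iInter fun x => ?_)
  exact isClosed_le continuous_const (by fun_prop)

theorem isCompact_setOf_mem_unitaryGroup :
    IsCompact {U : Matrix (Fin n) (Fin n) ℂ | U ∈ unitaryGroup (Fin n) ℂ} := by
  have hK : IsCompact (Set.univ.pi fun _ : Fin n => Set.univ.pi fun _ : Fin n =>
      Metric.closedBall (0 : ℂ) 1) :=
    isCompact_univ_pi fun _ => isCompact_univ_pi fun _ => isCompact_closedBall 0 1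
  refine IsCompact.of_isClosed_subset hK ?_ fun U hU i _ j _ => ?_
  · have h : {U : Matrix (Fin n) (Fin n) ℂ | U ∈ unitaryGroup (Fin n) ℂ} = {U | U * Uᴴ = 1} := by
      ext U
      simp [mem_unitaryGroup_iff, star_eq_conjTranspose]
    rw [h]
    exact isClosed_eq (by fun_prop) continuous_const
  · simpa using entry_norm_bound_of_unitary hU i j

/-- The Hermitian matrices whose eigenvalues lie in `[ε, R]`. -/
def spectralBox (n : ℕ) (ε R : ℝ) : Set (Matrix (Fin n) (Fin n) ℂ) :=
  (fun p : Matrix (Fin n) (Fin n) ℂ × (Fin n → ℝ) =>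
    p.1 * diagonal (fun i => (p.2 i : ℂ)) * p.1ᴴ) ''
    ({U | U ∈ unitaryGroup (Fin n) ℂ} ×ˢ Set.univ.pi fun _ => Set.Icc ε R)

theorem isCompact_spectralBox (ε R : ℝ) : IsCompact (spectralBox n ε R) := by
  refine (isCompact_setOf_mem_unitaryGroup.prod
    (isCompact_univ_pi fun _ => isCompact_Icc)).image ?_
  fun_prop

theorem posDef_of_mem_spectralBox {ε R : ℝ} (hε : 0 < ε) {X : Matrix (Fin n) (Fin n) ℂ}
    (hX : X ∈ spectralBox n ε R) : X.PosDef := by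
  obtain ⟨⟨U, d⟩, ⟨hU, hd⟩, rfl⟩ := hX
  have hU' : IsUnit U := (Unitary.toUnits ⟨U, hU⟩).isUnit
  refine (Matrix.IsUnit.posDef_star_right_conjugate_iff hU').2 (PosDef.diagonal fun i => ?_)
  exact_mod_cast hε.trans_le (hd i trivial).1

theorem IsHermitian.mem_spectralBox {ε R : ℝ} {X : Matrix (Fin n) (Fin n) ℂ}
    (hX : X.IsHermitian) (h : ∀ i, hX.eigenvalues i ∈ Set.Icc ε R) : X ∈ spectralBox n ε R := by
  refine ⟨⟨hX.eigenvectorUnitary, hX.eigenvalues⟩,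
    ⟨hX.eigenvectorUnitary.2, fun i _ => h i⟩, ?_⟩
  have h3 := hX.spectral_theorem
  rw [Unitary.conjStarAlgAut_apply] at h3
  exact h3.symm

theorem det_real_smul (c : ℝ) (X : Matrix (Fin n) (Fin n) ℂ) :
    (c • X).det.re = c ^ n * X.det.re := by
  have h : c • X = (c : ℂ) • X := by ext; simp
  rw [h, det_smul, Fintype.card_fin, ← Complex.ofReal_pow, Complex.re_ofReal_mul]

theorem one_half_smul (X : Matrix (Fin n) (Fin n) ℂ) : (1 / 2 : ℂ) • X = (1 / 2 : ℝ) • X := by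
  ext; simp

theorem inv_real_smul {c : ℝ} (hc : c ≠ 0) {X : Matrix (Fin n) (Fin n) ℂ} (hX : X.det ≠ 0) :
    (c • X)⁻¹ = c⁻¹ • X⁻¹ := by
  refine inv_eq_left_inv ?_
  rw [smul_mul_smul_comm, inv_mul_cancel₀ hc, nonsing_inv_mul _ hX.isUnit, one_smul]

end Matrix

/-! ### Coercivity and existence of a minimizer -/

namespace SDivergence

open Matrix

variable {n m : ℕ}

theorem posDef_half_add {X A : Matrix (Fin n) (Fin n) ℂ} (hX : X.PosDef) (hA : A.PosDef) :
    ((1 / 2 : ℂ) • (X + A)).PosDef := by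
  rw [one_half_smul]
  exact (hX.add hA).real_smul (by norm_num)

theorem re_det_mul {X A : Matrix (Fin n) (Fin n) ℂ} (hX : X.PosDef) :
    (X * A).det.re = X.det.re * A.det.re := by
  rw [det_mul, ← hX.ofReal_re_det, Complex.re_ofReal_mul, Complex.ofReal_re]

theorem sDiv_eq {X A : Matrix (Fin n) (Fin n) ℂ} (hX : X.PosDef) (hA : A.PosDef) :
    sDiv X A = Real.log ((1 / 2 : ℂ) • (X + A)).det.re -
      1 / 2 * (Real.log X.det.re + Real.log A.det.re) := by
  rw [sDiv, re_det_mul hX, Real.log_mul hX.re_det_pos.ne' hA.re_det_pos.ne']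

/-- Replacing `A` by `a • 1` inside the first determinant lowers it and leaves a function of the
spectrum of `X` alone. -/
theorem sum_log_sub_le_sDiv {X A : Matrix (Fin n) (Fin n) ℂ} (hX : X.PosDef) (hA : A.PosDef)
    {a : ℝ} (ha : 0 < a) (haA : (A - a • 1).PosSemidef) :
    ∑ j, (Real.log ((hX.1.eigenvalues j + a) / 2) - 1 / 2 * Real.log (hX.1.eigenvalues j)) -
      1 / 2 * Real.log A.det.re ≤ sDiv X A := by
  have h1 : ((1 / 2 : ℝ) • (X + a • 1)).PosDef :=
    (hX.add (PosDef.one.real_smul ha)).real_smul (by norm_num)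
  have h2 : ((1 / 2 : ℝ) • (X + A) - (1 / 2 : ℝ) • (X + a • 1)).PosSemidef := by
    rw [← smul_sub, add_sub_add_left_eq_sub]
    exact haA.real_smul (by norm_num)
  have h3 := h1.log_re_det_le h2
  have h4 : ((1 / 2 : ℝ) • (X + a • 1)).det.re = ∏ j, (hX.1.eigenvalues j + a) / 2 := by
    rw [det_real_smul, hX.1.det_add_smul_one, Complex.ofReal_re, Finset.prod_div_distrib]
    simp [div_eq_inv_mul]
  have h5 : X.det.re = ∏ j, hX.1.eigenvalues j := by
    have := hX.1.det_add_smul_one 0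
    simp only [zero_smul, add_zero] at this
    rw [this, Complex.ofReal_re]
  have hpos := hX.eigenvalues_pos
  rw [h4, Real.log_prod fun j _ => by have := hpos j; positivity] at h3
  rw [sDiv_eq hX hA, one_half_smul, h5, Real.log_prod fun j _ => (hpos j).ne',
    Finset.sum_sub_distrib, ← Finset.mul_sum]
  linarith

/-- AM-GM. This lower bound for the other eigenvalues allows one eigenvalue to be isolated. -/
theorem half_log_le {a x : ℝ} (ha : 0 < a) (hx : 0 < x) :
    1 / 2 * Real.log a ≤ Real.log ((x + a) / 2) - 1 / 2 * Real.log x := by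
  have h : x * a ≤ ((x + a) / 2) ^ 2 := by nlinarith [sq_nonneg (x - a)]
  have h2 := Real.log_le_log (by positivity) h
  rw [Real.log_mul hx.ne' ha.ne', Real.log_pow] at h2
  push_cast at h2
  linarith

theorem mem_Icc_of_log_sub_le {a x B : ℝ} (ha : 0 < a) (hx : 0 < x)
    (h : Real.log ((x + a) / 2) - 1 / 2 * Real.log x ≤ B) :
    x ∈ Set.Icc (Real.exp (2 * (Real.log (a / 2) - B))) (Real.exp (2 * (B + Real.log 2))) := by
  have h1 : Real.log (a / 2) ≤ Real.log ((x + a) / 2) :=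
    Real.log_le_log (by positivity) (by linarith)
  have h2 : Real.log (x / 2) ≤ Real.log ((x + a) / 2) :=
    Real.log_le_log (by positivity) (by linarith)
  rw [Real.log_div hx.ne' two_ne_zero] at h2
  rw [Set.mem_Icc, ← Real.le_log_iff_exp_le hx, ← Real.log_le_iff_le_exp hx]
  constructor <;> linarith

variable {w : Fin m → ℝ} {A : Fin m → Matrix (Fin n) (Fin n) ℂ}

theorem le_objective (hw : ∀ i, 0 ≤ w i) (hw1 : ∑ i, w i = 1)
    {X : Matrix (Fin n) (Fin n) ℂ} {G : ℝ} {d : Fin m → ℝ} (h : ∀ i, G - d i ≤ sDiv X (A i)) :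
    G - ∑ i, w i * d i ≤ objective w A X := by
  have : ∑ i, w i * (G - d i) ≤ objective w A X :=
    Finset.sum_le_sum fun i _ => mul_le_mul_of_nonneg_left (h i) (hw i)
  simpa [mul_sub, Finset.sum_sub_distrib, ← Finset.sum_mul, hw1] using this

theorem objective_le (hw : ∀ i, 0 ≤ w i) (hw1 : ∑ i, w i = 1)
    {X : Matrix (Fin n) (Fin n) ℂ} {G : ℝ} {d : Fin m → ℝ} (h : ∀ i, sDiv X (A i) ≤ G - d i) :
    objective w A X ≤ G - ∑ i, w i * d i := by
  have : objective w A X ≤ ∑ i, w i * (G - d i) :=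
    Finset.sum_le_sum fun i _ => mul_le_mul_of_nonneg_left (h i) (hw i)
  simpa [mul_sub, Finset.sum_sub_distrib, ← Finset.sum_mul, hw1] using this

theorem continuousOn_objective (hA : ∀ i, (A i).PosDef) :
    ContinuousOn (objective w A) (posDefCone n) := by
  refine continuousOn_finsetSum _ fun i _ => ContinuousOn.mul continuousOn_const ?_
  refine ContinuousOn.sub (ContinuousOn.log ?_ ?_)
    (ContinuousOn.mul continuousOn_const (ContinuousOn.log ?_ ?_))
  · exact Continuous.continuousOn (by fun_prop)
  · exact fun X hX => (posDef_half_add hX (hA i)).re_det_pos.ne'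
  · exact Continuous.continuousOn (by fun_prop)
  · intro X hX
    rw [re_det_mul hX]
    exact (mul_pos (PosDef.re_det_pos hX) (hA i).re_det_pos).ne'

theorem exists_isMinOn_objective (hw : ∀ i, 0 ≤ w i) (hw1 : ∑ i, w i = 1)
    (hA : ∀ i, (A i).PosDef) :
    ∃ X ∈ posDefCone n, IsMinOn (objective w A) (posDefCone n) X := by
  obtain ⟨a, ha, haA⟩ := exists_pos_forall_sub_smul_one_posSemidef hA
  set D := ∑ i, w i * (1 / 2 * Real.log (A i).det.re) with hD
  -- Bound for one eigenvalue's term when `h(X) ≤ h(1)`: the other `n - 1` terms are each at least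
  -- `1/2 log a`.
  set B := objective w A 1 + D - n * (1 / 2 * Real.log a) + 1 / 2 * Real.log a with hB
  set K := spectralBox n (Real.exp (2 * (Real.log (a / 2) - B)))
    (Real.exp (2 * (B + Real.log 2))) with hK
  have hKP : K ⊆ posDefCone n := fun X hX => posDef_of_mem_spectralBox (Real.exp_pos _) hX
  have hmem : ∀ X ∈ posDefCone n, objective w A X ≤ objective w A 1 → X ∈ K := by
    intro X hX hle
    have hX' : X.PosDef := hX
    refine hX'.1.mem_spectralBox fun j => mem_Icc_of_log_sub_le ha (hX'.eigenvalues_pos j) ?_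
    have h1 := le_objective hw hw1 fun i => sum_log_sub_le_sDiv hX' (hA i) ha (haA i)
    have h2 := Finset.single_le_sum
      (f := fun j => Real.log ((hX'.1.eigenvalues j + a) / 2) -
        1 / 2 * Real.log (hX'.1.eigenvalues j) - 1 / 2 * Real.log a)
      (fun j _ => sub_nonneg.2 (half_log_le ha (hX'.eigenvalues_pos j))) (Finset.mem_univ j)
    rw [Finset.sum_sub_distrib, Finset.sum_const, Finset.card_univ, Fintype.card_fin,
      nsmul_eq_mul] at h2
    linarith
  have h1 : (1 : Matrix (Fin n) (Fin n) ℂ) ∈ K := hmem 1 PosDef.one le_rfl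
  obtain ⟨X, hXK, hX⟩ := (isCompact_spectralBox _ _).exists_isMinOn ⟨1, h1⟩
    ((continuousOn_objective (w := w) hA).mono hKP)
  refine ⟨X, hKP hXK, isMinOn_iff.2 fun Y hY => ?_⟩
  by_cases hY1 : objective w A Y ≤ objective w A 1
  · exact isMinOn_iff.1 hX Y (hmem Y hY hY1)
  · exact (isMinOn_iff.1 hX 1 h1).trans (not_le.1 hY1).le

/-! ### First-order condition -/

theorem meanEquation_of_isMinOn (hw1 : ∑ i, w i = 1)
    (hA : ∀ i, (A i).PosDef) {X : Matrix (Fin n) (Fin n) ℂ} (hX : X.PosDef)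
    (hmin : IsMinOn (objective w A) (posDefCone n) X) : MeanEquation w A X := by
  set Z : Fin m → Matrix (Fin n) (Fin n) ℂ := fun i => (1 / 2 : ℂ) • (X + A i) with hZ
  have hZP : ∀ i, (Z i).PosDef := fun i => posDef_half_add hX (hA i)
  -- `M / 2` is the gradient of `h` at `X`, so the derivative along `M` itself is `tr (M * M) / 2`,
  -- which vanishes only for `M = 0`.
  set M := ∑ i, (w i : ℂ) • (Z i)⁻¹ - X⁻¹ with hM
  have hMH : M.IsHermitian := by
    refine IsHermitian.sub ?_ hX.inv.1
    simp only [IsHermitian, conjTranspose_sum, conjTranspose_smul, (hZP _).inv.1.eq]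
    simp
  have hd : HasDerivAt (fun t : ℝ => objective w A (X + t • M))
      (∑ i, w i * (((Z i)⁻¹ * ((1 / 2 : ℂ) • M)).trace.re -
        1 / 2 * ((X * A i)⁻¹ * (M * A i)).trace.re)) 0 := by
    refine HasDerivAt.fun_sum fun i _ => HasDerivAt.const_mul _ (HasDerivAt.sub ?_
      (HasDerivAt.const_mul _ ?_))
    · have h : ∀ t : ℝ, (1 / 2 : ℂ) • (X + t • M + A i) = Z i + t • (1 / 2 : ℂ) • M := fun t => by
        rw [hZ, smul_comm _ (1 / 2 : ℂ), ← smul_add, add_right_comm]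
      simpa only [h] using hasDerivAt_log_re_det_add_smul (hZP i).det_pos ((1 / 2 : ℂ) • M)
    · have h : 0 < (X * A i).det := by
        rw [det_mul]
        exact mul_pos hX.det_pos (hA i).det_pos
      simpa only [add_mul, smul_mul_assoc] using hasDerivAt_log_re_det_add_smul h (M * A i)
  have hlocal : IsLocalMin (fun t : ℝ => objective w A (X + t • M)) 0 := by
    filter_upwards [hX.eventually_add_smul hMH] with t ht
    simpa using isMinOn_iff.1 hmin _ ht
  have h0 := hlocal.hasDerivAt_eq_zero hd
  have hterm : ∀ i, ((X * A i)⁻¹ * (M * A i)).trace = (X⁻¹ * M).trace := fun i => by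
    rw [Matrix.mul_inv_rev, trace_mul_comm, mul_assoc, ← mul_assoc (A i),
      mul_nonsing_inv _ (hA i).det_pos.ne'.isUnit, one_mul, trace_mul_comm]
  have h1 : (M * M).trace.re = 0 := by
    have h2 : (M * M).trace.re = 2 * ∑ i, w i * (((Z i)⁻¹ * ((1 / 2 : ℂ) • M)).trace.re -
        1 / 2 * ((X * A i)⁻¹ * (M * A i)).trace.re) := by
      conv_lhs => rw [hM, sub_mul, trace_sub, Finset.sum_mul, trace_sum, ← hM]
      simp only [hterm, mul_sub, Finset.sum_sub_distrib, ← Finset.sum_mul, hw1, smul_mul_assoc,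
        mul_smul_comm, trace_smul, Complex.sub_re, Complex.re_sum, smul_eq_mul,
        Complex.re_ofReal_mul]
      have h3 : ∀ z : ℂ, (1 / 2 * z).re = 1 / 2 * z.re := fun z => by simp
      simp only [h3, mul_left_comm _ (1 / 2 : ℝ), ← Finset.mul_sum]
      ring
    rw [h2, h0, mul_zero]
  have h4 : M = 0 := by
    rw [← trace_conjTranspose_mul_self_eq_zero_iff, hMH.eq]
    have h5 := (posSemidef_conjTranspose_mul_self M).trace_nonneg
    rw [hMH.eq] at h5
    exact Complex.ext h1 (Complex.le_def.1 h5).2.symm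
  exact (sub_eq_zero.1 h4).symm

/-! ### Uniqueness through the Loewner order -/

theorem exists_pos_sub_smul_add_posSemidef (hA : ∀ i, (A i).PosDef)
    {X : Matrix (Fin n) (Fin n) ℂ} (hX : X.IsHermitian) :
    ∃ κ : ℝ, 0 < κ ∧ κ ≤ 1 ∧ ∀ i, (A i - κ • (X + A i)).PosSemidef := by
  obtain ⟨a, ha, haA⟩ := exists_pos_forall_sub_smul_one_posSemidef hA
  obtain ⟨b, hb⟩ := hX.exists_smul_one_sub_posSemidef
  have hab : 0 < a + |b| := by positivity
  have h1 : a / (a + |b|) ≤ 1 := (div_le_one hab).2 (by linarith [abs_nonneg b])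
  have h2 : a / (a + |b|) * (a + |b|) = a := div_mul_cancel₀ _ hab.ne'
  have h0 : 0 < a / (a + |b|) := by positivity
  -- From `a • 1 ≤ A i` and `X ≤ b • 1`, it suffices that `(1 - κ) a ≥ κ b`; `|b|` covers either
  -- sign of `b`.
  refine ⟨a / (a + |b|), h0, h1, fun i => ?_⟩
  generalize a / (a + |b|) = κ at *
  have h3 : 0 ≤ a - κ * (a + b) := by
    nlinarith [mul_le_mul_of_nonneg_left (le_abs_self b) h0.le]
  convert (((haA i).real_smul (sub_nonneg.2 h1)).add (hb.real_smul h0.le)).add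
    (PosSemidef.one.real_smul h3) using 1
  module

/-- Inversion reverses the order, so the bounds on `Y + A i` pass through the weighted sum to `Y⁻¹`,
and a second inversion returns to `Y`. -/
theorem MeanEquation.smul_sub_posSemidef (hw : ∀ i, 0 ≤ w i) (hA : ∀ i, (A i).PosDef)
    {X Y : Matrix (Fin n) (Fin n) ℂ} (hX : X.PosDef) (hY : Y.PosDef)
    (hXe : MeanEquation w A X) (hYe : MeanEquation w A Y) {c : ℝ} (hc : 0 < c)
    (h : ∀ i, (c • (X + A i) - (Y + A i)).PosSemidef) : (c • X - Y).PosSemidef := by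
  have h1 : (Y⁻¹ - c⁻¹ • X⁻¹).PosSemidef := by
    rw [hXe, hYe, Finset.smul_sum, ← Finset.sum_sub_distrib]
    refine posSemidef_sum _ fun i _ => ?_
    have hXi := posDef_half_add hX (hA i)
    rw [smul_comm, ← inv_real_smul hc.ne' hXi.det_pos.ne', ← smul_sub]
    have h2 : (((1 / 2 : ℂ) • (Y + A i))⁻¹ - (c • (1 / 2 : ℂ) • (X + A i))⁻¹).PosSemidef := by
      refine (posDef_half_add hY (hA i)).inv_sub_inv_posSemidef ?_
      rw [smul_comm, ← smul_sub, one_half_smul]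
      exact (h i).real_smul (by norm_num)
    exact h2.smul (by exact_mod_cast hw i)
  have h3 := (hX.inv.real_smul (inv_pos.2 hc)).inv_sub_inv_posSemidef h1
  rwa [inv_real_smul (inv_ne_zero hc.ne') hX.inv.det_pos.ne', inv_inv,
    nonsing_inv_nonsing_inv _ hX.det_pos.ne'.isUnit,
    nonsing_inv_nonsing_inv _ hY.det_pos.ne'.isUnit] at h3

theorem MeanEquation.sub_posSemidef (hw : ∀ i, 0 ≤ w i) (hA : ∀ i, (A i).PosDef)
    {X Y : Matrix (Fin n) (Fin n) ℂ} (hX : X.PosDef) (hY : Y.PosDef)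
    (hXe : MeanEquation w A X) (hYe : MeanEquation w A Y) : (X - Y).PosSemidef := by
  set S : Set ℝ := Set.Ici 1 ∩ (fun c : ℝ => c • X - Y) ⁻¹' {M | M.PosSemidef} with hS
  have hclosed : IsClosed S :=
    isClosed_Ici.inter (isClosed_setOf_posSemidef.preimage (by fun_prop))
  have hbdd : BddBelow S := ⟨1, fun c hc => hc.1⟩
  have hne : S.Nonempty := by
    obtain ⟨a, ha, haX⟩ := hX.exists_pos_sub_smul_one_posSemidef
    obtain ⟨b, hb⟩ := hY.1.exists_smul_one_sub_posSemidef
    refine ⟨max 1 (b / a), Set.mem_Ici.2 (le_max_left _ _), ?_⟩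
    have h1 : b ≤ max 1 (b / a) * a := (div_le_iff₀ ha).1 (le_max_right _ _)
    have h2 : 0 ≤ max 1 (b / a) := zero_le_one.trans (le_max_left _ _)
    show (_ • X - Y).PosSemidef
    convert ((haX.real_smul h2).add hb).add (PosSemidef.one.real_smul (sub_nonneg.2 h1)) using 1
    module
  obtain ⟨hc1, hcX⟩ := hclosed.csInf_mem hne hbdd
  set c := sInf S with hc
  obtain ⟨κ, hκ0, hκ1, hκ⟩ := exists_pos_sub_smul_add_posSemidef hA hX.1
  have hc1' : 1 ≤ c := hc1
  -- `c (X + A i) - (Y + A i) = (c X - Y) + (c - 1) A i` and `A i ≥ κ (X + A i)`, so `c` improves to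
  -- `c - κ (c - 1)`; minimality forces `c = 1`.
  have h1 : 1 ≤ c - κ * (c - 1) := by nlinarith
  have h2 : c - κ * (c - 1) ∈ S := by
    refine ⟨h1, MeanEquation.smul_sub_posSemidef hw hA hX hY hXe hYe (by linarith) fun i => ?_⟩
    convert PosSemidef.add hcX ((hκ i).real_smul (sub_nonneg.2 hc1')) using 1
    module
  have h3 : c ≤ c - κ * (c - 1) := csInf_le hbdd h2
  have h4 : c = 1 := by nlinarith
  have h5 : (c • X - Y).PosSemidef := hcX
  rwa [h4, one_smul] at h5

theorem MeanEquation.unique (hw : ∀ i, 0 ≤ w i) (hA : ∀ i, (A i).PosDef)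
    {X Y : Matrix (Fin n) (Fin n) ℂ} (hX : X.PosDef) (hY : Y.PosDef)
    (hXe : MeanEquation w A X) (hYe : MeanEquation w A Y) : X = Y := by
  have h1 := hXe.sub_posSemidef hw hA hX hY hYe
  have h2 := hYe.sub_posSemidef hw hA hY hX hXe
  open scoped MatrixOrder in exact le_antisymm (Matrix.le_iff.2 h2) (Matrix.le_iff.2 h1)

/-! ### Failure of convexity -/

theorem log_re_det_smul_one {T : ℝ} :
    Real.log (T • (1 : Matrix (Fin n) (Fin n) ℂ)).det.re = n * Real.log T := by
  rw [det_real_smul, det_one, Complex.one_re, mul_one, Real.log_pow]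

theorem le_objective_smul_one (hw : ∀ i, 0 ≤ w i) (hw1 : ∑ i, w i = 1)
    (hA : ∀ i, (A i).PosDef) {T : ℝ} (hT : 0 < T) :
    n * (1 / 2 * Real.log T - Real.log 2) - ∑ i, w i * (1 / 2 * Real.log (A i).det.re) ≤
      objective w A (T • 1) := by
  refine le_objective hw hw1 fun i => ?_
  have hT1 : (T • (1 : Matrix (Fin n) (Fin n) ℂ)).PosDef := PosDef.one.real_smul hT
  have h1 : ((T / 2) • (1 : Matrix (Fin n) (Fin n) ℂ)).PosDef := PosDef.one.real_smul (by linarith)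
  have h2 := h1.log_re_det_le (Y := (1 / 2 : ℂ) • (T • 1 + A i)) (by
    rw [one_half_smul]
    convert (hA i).posSemidef.real_smul (c := 1 / 2) (by norm_num) using 1
    module)
  rw [log_re_det_smul_one, Real.log_div hT.ne' two_ne_zero] at h2
  rw [sDiv_eq hT1 (hA i), log_re_det_smul_one]
  linarith

theorem objective_smul_one_le (hw : ∀ i, 0 ≤ w i) (hw1 : ∑ i, w i = 1)
    (hA : ∀ i, (A i).PosDef) {b T : ℝ} (hb : ∀ i, (b • 1 - A i).PosSemidef) (hT : 0 < T)
    (hbT : b ≤ T) :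
    objective w A (T • 1) ≤
      n * (1 / 2 * Real.log T) - ∑ i, w i * (1 / 2 * Real.log (A i).det.re) := by
  refine objective_le hw hw1 fun i => ?_
  have hT1 : (T • (1 : Matrix (Fin n) (Fin n) ℂ)).PosDef := PosDef.one.real_smul hT
  have h2 := (posDef_half_add hT1 (hA i)).log_re_det_le (Y := T • 1) (by
    rw [one_half_smul]
    convert (PosSemidef.add (hb i) (PosSemidef.one.real_smul (sub_nonneg.2 hbT))).real_smul
      (c := 1 / 2) (by norm_num) using 1
    module)
  rw [log_re_det_smul_one] at h2
  rw [sDiv_eq hT1 (hA i), log_re_det_smul_one]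
  linarith

/-- As `t • 1` is the mean of `1` and `t ^ 2 • 1` with weights `t / (t + 1)` and `1 / (t + 1)`,
convexity would keep `h (t • 1)` bounded as `t → ∞`, against its logarithmic growth. -/
theorem not_convexOn_objective (hw : ∀ i, 0 ≤ w i) (hw1 : ∑ i, w i = 1)
    (hA : ∀ i, (A i).PosDef) (hn : 0 < n) :
    ¬ ConvexOn ℝ (posDefCone n) (objective w A) := by
  intro hconv
  obtain ⟨b, hb⟩ := exists_forall_smul_one_sub_posSemidef fun i => (hA i).1
  set D := ∑ i, w i * (1 / 2 * Real.log (A i).det.re) with hD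
  set E := |objective w A 1 + n * Real.log 2 + D| with hE
  -- With `s = log t`, convexity will give `t s / 4 ≤ t (E + n log 2)`, which this `s` violates; `b
  -- ≤ s` makes the upper bound available at `t ^ 2`.
  set s := max (max 1 b) (4 * (E + n * Real.log 2) + 1) with hs
  have hs1 : 1 ≤ s := (le_max_left _ _).trans (le_max_left _ _)
  have hsb : b ≤ s := (le_max_right _ _).trans (le_max_left _ _)
  have hsE : 4 * (E + n * Real.log 2) + 1 ≤ s := le_max_right _ _
  set t := Real.exp s with ht
  have hts : s + 1 ≤ t := Real.add_one_le_exp s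
  have ht2 : 2 ≤ t := by linarith
  have ht0 : 0 < t := by linarith
  have hlog : Real.log t = s := Real.log_exp s
  have h1 := le_objective_smul_one hw hw1 hA ht0
  have h2 := objective_smul_one_le hw hw1 hA hb (T := t ^ 2) (by positivity) (by nlinarith)
  rw [hlog] at h1
  rw [Real.log_pow, hlog] at h2
  push_cast at h2
  have h3 := hconv.2 (show 1 ∈ posDefCone n from PosDef.one)
    (show (t ^ 2) • 1 ∈ posDefCone n from PosDef.one.real_smul (by positivity))
    (show 0 ≤ t / (t + 1) by positivity) (show 0 ≤ 1 / (t + 1) by positivity) (by field_simp)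
  have h4 : (t / (t + 1)) • (1 : Matrix (Fin n) (Fin n) ℂ) + (1 / (t + 1)) • (t ^ 2) • 1 =
      t • 1 := by
    rw [smul_smul, ← add_smul]
    congr 1
    field_simp
    ring
  rw [h4, smul_eq_mul, smul_eq_mul] at h3
  have h5 : (t + 1) * objective w A (t • 1) ≤
      t * objective w A 1 + objective w A (t ^ 2 • 1) := by
    have e : ∀ p q : ℝ, (t + 1) * (t / (t + 1) * p + 1 / (t + 1) * q) = t * p + q := fun p q => by
      field_simp
    rw [← e]
    exact mul_le_mul_of_nonneg_left h3 (by linarith)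
  have h6 : (t + 1) * (n * (1 / 2 * s - Real.log 2) - D) ≤
      t * objective w A 1 + (n * s - D) := by
    have := mul_le_mul_of_nonneg_left h1 (by linarith : 0 ≤ t + 1)
    linarith
  have hn1 : (1 : ℝ) ≤ n := by exact_mod_cast hn
  have hl : 0 ≤ Real.log 2 := Real.log_nonneg (by norm_num)
  have hEle : objective w A 1 + n * Real.log 2 + D ≤ E := le_abs_self _
  have hE0 : 0 ≤ E := abs_nonneg _
  have h7 : (t - 1) * (n * s / 2) ≤ t * E + n * Real.log 2 := by
    nlinarith [mul_le_mul_of_nonneg_left hEle ht0.le]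
  have hns : s ≤ n * s := le_mul_of_one_le_left (by linarith) hn1
  have h8 : t * s / 4 ≤ (t - 1) * (n * s / 2) := by nlinarith
  have h9 : n * Real.log 2 ≤ t * (n * Real.log 2) :=
    le_mul_of_one_le_left (by positivity) (by linarith)
  nlinarith

end SDivergence

theorem mainTheorem4 (n m : ℕ) (w : Fin m → ℝ) (hw : ∀ i, 0 ≤ w i) (hw1 : ∑ i, w i = 1)
    (A : Fin m → Matrix (Fin n) (Fin n) ℂ) (hA : ∀ i, (A i).PosDef) :
    (∃! X : Matrix (Fin n) (Fin n) ℂ, X.PosDef ∧ SDivergence.MeanEquation w A X) ∧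
    (∀ X : Matrix (Fin n) (Fin n) ℂ, X.PosDef → SDivergence.MeanEquation w A X →
      IsMinOn (SDivergence.objective w A) (SDivergence.posDefCone n) X ∧
      ∀ Y ∈ SDivergence.posDefCone n,
        IsMinOn (SDivergence.objective w A) (SDivergence.posDefCone n) Y → Y = X) ∧
    (0 < n →
      ¬ ConvexOn ℝ (SDivergence.posDefCone n) (SDivergence.objective w A)) := by
  obtain ⟨X₀, hX₀, hmin⟩ := SDivergence.exists_isMinOn_objective hw hw1 hA
  have hsol := SDivergence.meanEquation_of_isMinOn hw1 hA hX₀ hmin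
  refine ⟨⟨X₀, ⟨hX₀, hsol⟩, fun X hX => hX.2.unique hw hA hX.1 hX₀ hsol⟩, fun X hX hXe => ⟨?_, ?_⟩,
    SDivergence.not_convexOn_objective hw hw1 hA⟩
  · rwa [hXe.unique hw hA hX hX₀ hsol]
  · intro Y hY hYmin
    exact (SDivergence.meanEquation_of_isMinOn hw1 hA hY hYmin).unique hw hA hY hX hXe
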